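/- For an interval $J$ write $\langle f\rangle_J=\frac1{|J|}\int_J f\,dx$, and for a dyadic interval $J=[j2^{-s},(j+1)2^{-s})$, $j,s\in\mathbb Z$, let $J^-$ and $J^+$ be its left and right halves, $J^{+-}=(J^+)^-$, $J^{++}=(J^+)^+$. For an integer $k\ge 2$ put $$\varepsilon=4^{-k},\qquad \tau=\frac{9\varepsilon}{1+5\varepsilon},\qquad p=\frac{\frac23(1-\varepsilon)+2\varepsilon\tau}{4\varepsilon}.$$ For a dyadic interval $I$ put $I_0=I$, $I_{m+1}=I_m^{++}$, and for $\omega,\sigma>0$ with $\omega\sigma=p$ define weights on $I$ recursively by $$w_0(\omega,\sigma,I)=\frac{\omega}{\sqrt p}\Big((\sqrt p-\sqrt{p-1})\chi_{I^-}+(\sqrt p+\sqrt{p-1})\chi_{I^+}\Big),$$ $$w_n(\omega,\sigma,I)=\sum_{m=0}^{k-2}w_{n-1}\big(3\omega,\sigma/3,I_m^{+-}\big)+\frac{\omega}{p}\Big(\sum_{m=0}^{k-2}\chi_{I_m^-}+\chi_{I_{k-1}^-}+\tau\,\chi_{I_{k-1}^+}\Big),\qquad n\ge1.$$ For a weight $w$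 on $I$ let $[w]_{A_2^d(I)}=\sup_{J}\langle w\rangle_J\langle w^{-1}\rangle_J$, the supremum being over all dyadic intervals $J\subseteq I$. Lemma. There are absolute constants $0<c\le C<\infty$ such that for all $k\ge2$, all $n\ge1$ (in particular for $n=4^k$), all $\omega,\sigma>0$ with $\omega\sigma=p$, and all dyadic intervals $I$, $$c\,p^2\le [w_n(\omega,\sigma,I)]_{A_2^d(I)}\le C\,p^2 .$$ -/

import Mathlib

open MeasureTheory
open scoped ENNReal

/-- The dyadic interval `[index * 2^(-scale), (index + 1) * 2^(-scale))` of the real line,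
given by its two integers. -/
@[ext] structure DyadicInterval where
  scale : ℤ
  index : ℤ

namespace DyadicInterval

/-- The underlying subset of the line. -/
def toSet (I : DyadicInterval) : Set ℝ :=
  Set.Ico ((I.index : ℝ) * (2 : ℝ) ^ (-I.scale)) (((I.index : ℝ) + 1) * (2 : ℝ) ^ (-I.scale))

/-- The left child `I^-`. -/
def left (I : DyadicInterval) : DyadicInterval := ⟨I.scale + 1, 2 * I.index⟩

/-- The right child `I^+`. -/
def right (I : DyadicInterval) : DyadicInterval := ⟨I.scale + 1, 2 * I.index + 1⟩

/-- The intervals `I_0 = I`, `I_(m+1) = (I_m)^(++)`. -/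
def tower (I : DyadicInterval) : ℕ → DyadicInterval
  | 0 => I
  | m + 1 => (I.tower m).right.right

/-- The characteristic function of `I`. -/
noncomputable def chi (I : DyadicInterval) : ℝ → ℝ := I.toSet.indicator (fun _ => 1)

end DyadicInterval

/-- `ε = 4^(-k)`. -/
noncomputable def epsK (k : ℕ) : ℝ := 1 / 4 ^ k

/-- `τ = 9ε / (1 + 5ε)`. -/
noncomputable def tauK (k : ℕ) : ℝ := 9 * epsK k / (1 + 5 * epsK k)

/-- The number `p`, which is the solution of
`((2/3)(1 - ε) + 2ετ) / p - 4ε = 0`; it is `1/(6ε)` up to a bounded error. -/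
noncomputable def pK (k : ℕ) : ℝ :=
  (2 / 3 * (1 - epsK k) + 2 * epsK k * tauK k) / (4 * epsK k)

/-- The weight `w_n(ω, σ, I)` with parameter `k`. The sums over `Finset.range (k - 1)` are the sums
over `0 ≤ m ≤ k - 2`. As in the usual formula, `σ` is carried along (always `ω σ = p`). -/
noncomputable def weightW (k : ℕ) : ℕ → ℝ → ℝ → DyadicInterval → ℝ → ℝ
  | 0, ω, _, I, x =>
      ω / √(pK k) * ((√(pK k) - √(pK k - 1)) * I.left.chi x
        + (√(pK k) + √(pK k - 1)) * I.right.chi x)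
  | n + 1, ω, σ, I, x =>
      (∑ m ∈ Finset.range (k - 1), weightW k n (3 * ω) (σ / 3) (I.tower m).right.left x)
        + ω / pK k * ((∑ m ∈ Finset.range (k - 1), (I.tower m).left.chi x)
          + (I.tower (k - 1)).left.chi x
          + tauK k * (I.tower (k - 1)).right.chi x)

/-- The dyadic `A_2` characteristic of `w` on `I`: the supremum of `⟨w⟩_J ⟨w⁻¹⟩_J` over all dyadic
intervals `J ⊆ I`, as an extended nonnegative number. -/
noncomputable def dyadicA2 (w : ℝ → ℝ) (I : DyadicInterval) : ℝ≥0∞ :=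
  ⨆ (J : DyadicInterval) (_ : J.toSet ⊆ I.toSet),
    (⨍⁻ x in J.toSet, ENNReal.ofReal (w x) ∂volume) *
      (⨍⁻ x in J.toSet, (ENNReal.ofReal (w x))⁻¹ ∂volume)

/-!
The weight `w_n` on `I` is assembled from the pieces `I_m^-`, `I_m^{+-}` and `I_{k-1}^±`. It is
constant on the first and last kind, and on `I_m^{+-}` it is a copy of `w_{n-1}`, whose averages
are `3ω` and, for the reciprocal, `σ/3`. Since `I_m = I_m^- ∪ I_m^{+-} ∪ I_{m+1}` in proportions
`1/2, 1/4, 1/4`, the averages over `I_{k-1-j}` obey the affine recursion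
`A_{j+1} = a/2 + b/4 + A_j/4`, solved by `stackAvg`. The choice of `p` and `τ` makes the averages of
`w_n` and `w_n⁻¹` over `I` equal to `ω` and `σ` again, so the induction on `n` closes.

A dyadic `J ⊆ I` is one of the `I_m`, one of the `I_m^+`, or lies in a piece. In a constant piece
the product of averages is `1`; inside `I_m^{+-}` the induction hypothesis applies; on `I_m` the
averages are at most `2ω` and `pσ`, and passing to `I_m^+` at most doubles each of them. This gives
the upper bound `8 p²` (`dyadicA2_weightW_le`). For the lower bound, `J = I_{k-2}` has averages at
least `3ω/4` and `σ/(8τ)`, and `1/τ` is comparable to `p`.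
-/

/-! ### Dyadic intervals -/

namespace DyadicInterval

lemma measurableSet_toSet (I : DyadicInterval) : MeasurableSet I.toSet := measurableSet_Ico

lemma volume_toSet (I : DyadicInterval) :
    volume I.toSet = ENNReal.ofReal ((2 : ℝ) ^ (-I.scale)) := by
  rw [toSet, Real.volume_Ico]
  congr 1
  ring

lemma volume_toSet_ne_zero (I : DyadicInterval) : volume I.toSet ≠ 0 := by
  rw [volume_toSet, Ne, ENNReal.ofReal_eq_zero, not_le]
  positivity

lemma volume_toSet_ne_top (I : DyadicInterval) : volume I.toSet ≠ ∞ := by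
  rw [volume_toSet]
  exact ENNReal.ofReal_ne_top

lemma two_zpow_neg_eq (s : ℤ) : (2 : ℝ) ^ (-s) = 2 * (2 : ℝ) ^ (-(s + 1)) := by
  rw [show -s = -(s + 1) + 1 by ring, zpow_add_one₀ two_ne_zero]
  ring

lemma mem_left_iff (I : DyadicInterval) (x : ℝ) : x ∈ I.left.toSet ↔
    2 * I.index * (2 : ℝ) ^ (-(I.scale + 1)) ≤ x ∧
      x < (2 * I.index + 1) * (2 : ℝ) ^ (-(I.scale + 1)) := by
  simp [toSet, left]

lemma mem_right_iff (I : DyadicInterval) (x : ℝ) : x ∈ I.right.toSet ↔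
    (2 * I.index + 1) * (2 : ℝ) ^ (-(I.scale + 1)) ≤ x ∧
      x < (2 * I.index + 2) * (2 : ℝ) ^ (-(I.scale + 1)) := by
  simp only [toSet, right, Set.mem_Ico]
  push_cast
  rw [show (2 * (I.index : ℝ) + 1 + 1) = 2 * I.index + 2 by ring]

lemma toSet_eq_union (I : DyadicInterval) : I.toSet = I.left.toSet ∪ I.right.toSet := by
  ext x
  rw [Set.mem_union, mem_left_iff, mem_right_iff, toSet, Set.mem_Ico, two_zpow_neg_eq]
  have h : (0 : ℝ) < (2 : ℝ) ^ (-(I.scale + 1)) := by positivity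
  constructor
  · rintro ⟨h1, h2⟩
    by_cases hx : x < (2 * I.index + 1) * (2 : ℝ) ^ (-(I.scale + 1))
    · left; constructor <;> linarith
    · right; constructor <;> linarith
  · rintro (⟨h1, h2⟩ | ⟨h1, h2⟩) <;> constructor <;> linarith

lemma left_subset (I : DyadicInterval) : I.left.toSet ⊆ I.toSet :=
  I.toSet_eq_union ▸ Set.subset_union_left

lemma right_subset (I : DyadicInterval) : I.right.toSet ⊆ I.toSet :=
  I.toSet_eq_union ▸ Set.subset_union_right

lemma notMem_right_of_mem_left {I : DyadicInterval} {x : ℝ} (hx : x ∈ I.left.toSet) :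
    x ∉ I.right.toSet := fun h =>
  absurd ((mem_left_iff I x).1 hx).2 (not_lt.2 ((mem_right_iff I x).1 h).1)

lemma notMem_left_of_mem_right {I : DyadicInterval} {x : ℝ} (hx : x ∈ I.right.toSet) :
    x ∉ I.left.toSet := fun h => notMem_right_of_mem_left h hx

lemma disjoint_left_right (I : DyadicInterval) : Disjoint I.left.toSet I.right.toSet :=
  Set.disjoint_left.2 fun _ => notMem_right_of_mem_left

lemma chi_of_mem {I : DyadicInterval} {x : ℝ} (hx : x ∈ I.toSet) : I.chi x = 1 :=
  Set.indicator_of_mem hx _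

lemma chi_of_notMem {I : DyadicInterval} {x : ℝ} (hx : x ∉ I.toSet) : I.chi x = 0 :=
  Set.indicator_of_notMem hx _

lemma tower_succ' (I : DyadicInterval) (m : ℕ) : I.tower (m + 1) = I.right.right.tower m := by
  induction m with
  | zero => rfl
  | succ m ih => rw [tower, ih, tower]

/-- A dyadic interval contained in `I` is `I` itself or lies in one of the two halves of `I`. -/
lemma eq_or_subset_left_or_right {I J : DyadicInterval} (h : J.toSet ⊆ I.toSet) :
    J = I ∨ J.toSet ⊆ I.left.toSet ∨ J.toSet ⊆ I.right.toSet := by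
  obtain ⟨s, i⟩ := I
  obtain ⟨t, j⟩ := J
  have ht : (0 : ℝ) < (2 : ℝ) ^ (-t) := by positivity
  have hne : (j : ℝ) * (2 : ℝ) ^ (-t) < ((j : ℝ) + 1) * (2 : ℝ) ^ (-t) := by linarith
  obtain ⟨h1, h2⟩ := (Set.Ico_subset_Ico_iff hne).1 h
  have hlen : (2 : ℝ) ^ (-t) ≤ (2 : ℝ) ^ (-s) := by linarith
  have hst : s ≤ t := by
    have := (zpow_le_zpow_iff_right₀ (by norm_num : (1 : ℝ) < 2)).1 hlen
    omega
  obtain ⟨d, rfl⟩ := Int.le.dest hst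
  have hpow : (2 : ℝ) ^ (-s) = 2 ^ d * (2 : ℝ) ^ (-(s + d)) := by
    rw [show -s = (d : ℤ) + -(s + d) by ring, zpow_add₀ two_ne_zero, zpow_natCast]
  rw [hpow, ← mul_assoc] at h1 h2
  have h1' : i * 2 ^ d ≤ j := by exact_mod_cast le_of_mul_le_mul_right h1 ht
  have h2' : j + 1 ≤ (i + 1) * 2 ^ d := by exact_mod_cast le_of_mul_le_mul_right h2 ht
  cases d with
  | zero =>
    left
    ext
    · simp
    · simp only [pow_zero, mul_one] at h1' h2'
      change j = i
      omega
  | succ e =>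
    right
    have hpow' : (2 : ℝ) ^ (-(s + 1)) = 2 ^ e * (2 : ℝ) ^ (-(s + (e + 1 : ℕ))) := by
      rw [show -(s + 1) = (e : ℤ) + -(s + (e + 1 : ℕ)) by push_cast; ring,
        zpow_add₀ two_ne_zero, zpow_natCast]
    rw [pow_succ] at h1' h2'
    rcases lt_or_ge j ((2 * i + 1) * 2 ^ e) with hj | hj
    · left
      apply Set.Ico_subset_Ico <;> simp only [left] <;> rw [hpow', ← mul_assoc]
      · have : (2 * i) * 2 ^ e ≤ j := by linarith
        exact mul_le_mul_of_nonneg_right (by exact_mod_cast this) ht.le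
      · have : j + 1 ≤ (2 * i + 1) * 2 ^ e := hj
        exact mul_le_mul_of_nonneg_right (by exact_mod_cast this) ht.le
    · right
      apply Set.Ico_subset_Ico <;> simp only [right] <;> rw [hpow', ← mul_assoc]
      · exact mul_le_mul_of_nonneg_right (by exact_mod_cast hj) ht.le
      · have : j + 1 ≤ (2 * i + 1 + 1) * 2 ^ e := by linarith
        exact mul_le_mul_of_nonneg_right (by exact_mod_cast this) ht.le

end DyadicInterval

open DyadicInterval

/-! ### Averages over dyadic intervals -/

lemma laverage_congr_on {g g' : ℝ → ℝ≥0∞} {J : DyadicInterval} (h : Set.EqOn g g' J.toSet) :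
    ⨍⁻ x in J.toSet, g x ∂volume = ⨍⁻ x in J.toSet, g' x ∂volume := by
  rw [setLAverage_eq, setLAverage_eq, setLIntegral_congr_fun J.measurableSet_toSet h]

lemma laverage_eq_of_const_on {g : ℝ → ℝ≥0∞} {a : ℝ≥0∞} {J : DyadicInterval}
    (h : ∀ x ∈ J.toSet, g x = a) : ⨍⁻ x in J.toSet, g x ∂volume = a := by
  rw [laverage_congr_on (g' := fun _ => a) h]
  exact setLAverage_const J.volume_toSet_ne_zero J.volume_toSet_ne_top a

/-- The integrand need not be measurable, since the two halves are. -/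
lemma laverage_eq_halves (g : ℝ → ℝ≥0∞) (J : DyadicInterval) :
    ⨍⁻ x in J.toSet, g x ∂volume =
      (⨍⁻ x in J.left.toSet, g x ∂volume) / 2 + (⨍⁻ x in J.right.toSet, g x ∂volume) / 2 := by
  have hv : volume J.toSet = volume J.left.toSet * 2 := by
    rw [volume_toSet, volume_toSet, two_zpow_neg_eq, ENNReal.ofReal_mul two_pos.le, mul_comm,
      ENNReal.ofReal_ofNat]
    rfl
  have hv' : volume J.right.toSet = volume J.left.toSet := by
    rw [volume_toSet, volume_toSet]
    rfl
  rw [setLAverage_eq, setLAverage_eq, setLAverage_eq, hv, hv', J.toSet_eq_union,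
    lintegral_union J.right.measurableSet_toSet J.disjoint_left_right]
  simp only [div_eq_mul_inv]
  rw [ENNReal.mul_inv (Or.inr (by norm_num)) (Or.inr (by norm_num))]
  ring

lemma laverage_right_le (g : ℝ → ℝ≥0∞) (J : DyadicInterval) :
    ⨍⁻ x in J.right.toSet, g x ∂volume ≤ 2 * ⨍⁻ x in J.toSet, g x ∂volume := by
  rw [laverage_eq_halves g J, mul_add, ENNReal.mul_div_cancel two_ne_zero (by norm_num),
    ENNReal.mul_div_cancel two_ne_zero (by norm_num)]
  exact le_add_self

/-! ### The dyadic `A_2` characteristic -/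

lemma dyadicA2_congr {w w' : ℝ → ℝ} {I : DyadicInterval} (h : Set.EqOn w w' I.toSet) :
    dyadicA2 w I = dyadicA2 w' I := by
  unfold dyadicA2
  refine iSup_congr fun J => iSup_congr fun hJ => ?_
  congr 1 <;> exact laverage_congr_on fun x hx => by simp only [h (hJ hx)]

lemma le_dyadicA2 (w : ℝ → ℝ) {I J : DyadicInterval} (h : J.toSet ⊆ I.toSet) :
    (⨍⁻ x in J.toSet, ENNReal.ofReal (w x) ∂volume) *
      (⨍⁻ x in J.toSet, (ENNReal.ofReal (w x))⁻¹ ∂volume) ≤ dyadicA2 w I :=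
  le_iSup₂_of_le J h le_rfl

lemma dyadicA2_le_of_halves {w : ℝ → ℝ} {I : DyadicInterval} {B : ℝ≥0∞}
    (h : (⨍⁻ x in I.toSet, ENNReal.ofReal (w x) ∂volume) *
      (⨍⁻ x in I.toSet, (ENNReal.ofReal (w x))⁻¹ ∂volume) ≤ B)
    (hl : dyadicA2 w I.left ≤ B) (hr : dyadicA2 w I.right ≤ B) : dyadicA2 w I ≤ B := by
  refine iSup₂_le fun J hJ => ?_
  rcases eq_or_subset_left_or_right hJ with rfl | hJ | hJ
  · exact h
  · exact (le_dyadicA2 w hJ).trans hl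
  · exact (le_dyadicA2 w hJ).trans hr

lemma dyadicA2_le_one_of_const_on {w : ℝ → ℝ} {v : ℝ} {I : DyadicInterval} (hv : 0 < v)
    (h : ∀ x ∈ I.toSet, w x = v) : dyadicA2 w I ≤ 1 := by
  refine iSup₂_le fun J hJ => ?_
  rw [laverage_eq_of_const_on (a := ENNReal.ofReal v) fun x hx => by rw [h x (hJ hx)],
    laverage_eq_of_const_on (a := (ENNReal.ofReal v)⁻¹) fun x hx => by rw [h x (hJ hx)],
    ENNReal.mul_inv_cancel (ENNReal.ofReal_pos.2 hv).ne' ENNReal.ofReal_ne_top]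

/-! ### Stacked weights -/

/-- The weight on `I` equal to `c` on `I_m^-` for `m ≤ j`, to `c * t` on `I_j^+`, and to
`F I_m^{+-}` on `I_m^{+-}` for `m < j`. The recursion on `j` peels `I^-` and `I^{+-}` off `I` and
leaves `I^{++} = I_1`. -/
noncomputable def stack (F : DyadicInterval → ℝ → ℝ) (c t : ℝ) :
    ℕ → DyadicInterval → ℝ → ℝ
  | 0, I, x => c * I.left.chi x + c * t * I.right.chi x
  | j + 1, I, x => c * I.left.chi x + F I.right.left x + stack F c t j I.right.right x

/-- The average of a `stack` of height `j` whose constant pieces have averages `a` (the `I_m^-`) and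
`d` (the last one), and whose pieces `I_m^{+-}` have average `b`. -/
noncomputable def stackAvg (a b d : ℝ) (j : ℕ) : ℝ :=
  (a + d) / 2 / 4 ^ j + (1 - 1 / 4 ^ j) * ((2 * a + b) / 3)

lemma stackAvg_succ (a b d : ℝ) (j : ℕ) :
    stackAvg a b d (j + 1) = a / 2 + (b / 2 + stackAvg a b d j / 2) / 2 := by
  unfold stackAvg
  rw [pow_succ]
  field_simp
  ring

lemma stackAvg_nonneg {a b d : ℝ} (ha : 0 ≤ a) (hb : 0 ≤ b) (hd : 0 ≤ d) (j : ℕ) :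
    0 ≤ stackAvg a b d j := by
  induction j with
  | zero => simp only [stackAvg]; norm_num; positivity
  | succ j ih => rw [stackAvg_succ]; positivity

lemma stackAvg_le {a b d : ℝ} (ha : 0 ≤ a) (hb : 0 ≤ b) (hd : 0 ≤ d) (j : ℕ) :
    stackAvg a b d j ≤ (a + d) / 2 + (2 * a + b) / 3 := by
  have h1 : (1 : ℝ) ≤ 4 ^ j := one_le_pow₀ (by norm_num)
  have h2 : (0 : ℝ) ≤ 1 / 4 ^ j := by positivity
  unfold stackAvg
  exact add_le_add (div_le_self (by positivity) h1)
    (mul_le_of_le_one_left (by positivity) (by linarith))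

section Stack

variable {F : DyadicInterval → ℝ → ℝ} {c t : ℝ}

lemma stack_eq_zero (hF : ∀ K x, x ∉ K.toSet → F K x = 0) (j : ℕ) (I : DyadicInterval) (x : ℝ)
    (hx : x ∉ I.toSet) : stack F c t j I x = 0 := by
  induction j generalizing I with
  | zero =>
    rw [stack, chi_of_notMem fun h => hx (I.left_subset h),
      chi_of_notMem fun h => hx (I.right_subset h)]
    ring
  | succ j ih =>
    rw [stack, chi_of_notMem fun h => hx (I.left_subset h),
      hF _ _ fun h => hx (I.right_subset (left_subset _ h)),
      ih _ fun h => hx (I.right_subset (right_subset _ h))]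
    ring

lemma stack_on_left (hF : ∀ K x, x ∉ K.toSet → F K x = 0) (j : ℕ) (I : DyadicInterval) {x : ℝ}
    (hx : x ∈ I.left.toSet) : stack F c t j I x = c := by
  have hr := notMem_right_of_mem_left hx
  cases j with
  | zero => rw [stack, chi_of_mem hx, chi_of_notMem hr]; ring
  | succ j =>
    rw [stack, chi_of_mem hx, hF _ _ fun h => hr (left_subset _ h),
      stack_eq_zero hF _ _ _ fun h => hr (right_subset _ h)]
    ring

lemma stack_zero_on_right (I : DyadicInterval) {x : ℝ} (hx : x ∈ I.right.toSet) :
    stack F c t 0 I x = c * t := by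
  rw [stack, chi_of_notMem (notMem_left_of_mem_right hx), chi_of_mem hx]
  ring

lemma stack_succ_on_right_left (hF : ∀ K x, x ∉ K.toSet → F K x = 0) (j : ℕ)
    (I : DyadicInterval) : Set.EqOn (stack F c t (j + 1) I) (F I.right.left)
      I.right.left.toSet := fun x hx => by
  rw [stack, chi_of_notMem (notMem_left_of_mem_right (left_subset _ hx)),
    stack_eq_zero hF _ _ _ (notMem_right_of_mem_left hx)]
  ring

lemma stack_succ_on_right_right (hF : ∀ K x, x ∉ K.toSet → F K x = 0) (j : ℕ)
    (I : DyadicInterval) : Set.EqOn (stack F c t (j + 1) I) (stack F c t j I.right.right)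
      I.right.right.toSet := fun x hx => by
  rw [stack, chi_of_notMem (notMem_left_of_mem_right (right_subset _ hx)),
    hF _ _ (notMem_left_of_mem_right hx)]
  ring

lemma ofReal_half_add_half {x y : ℝ} (hx : 0 ≤ x) (hy : 0 ≤ y) :
    ENNReal.ofReal x / 2 + ENNReal.ofReal y / 2 = ENNReal.ofReal (x / 2 + y / 2) := by
  rw [ENNReal.ofReal_add (by positivity) (by positivity), ENNReal.ofReal_div_of_pos two_pos,
    ENNReal.ofReal_div_of_pos two_pos, ENNReal.ofReal_ofNat]

/-- The averages of a stack, for any function `G` of its values; `G` is `ENNReal.ofReal` or its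
reciprocal below. -/
lemma laverage_stack (hF : ∀ K x, x ∉ K.toSet → F K x = 0) {G : ℝ → ℝ≥0∞} {a b d : ℝ}
    (ha : 0 ≤ a) (hb : 0 ≤ b) (hd : 0 ≤ d) (hGa : G c = ENNReal.ofReal a)
    (hGd : G (c * t) = ENNReal.ofReal d)
    (hGb : ∀ K : DyadicInterval, ⨍⁻ x in K.toSet, G (F K x) ∂volume = ENNReal.ofReal b)
    (j : ℕ) (I : DyadicInterval) :
    ⨍⁻ x in I.toSet, G (stack F c t j I x) ∂volume = ENNReal.ofReal (stackAvg a b d j) := by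
  induction j generalizing I with
  | zero =>
    rw [laverage_eq_halves,
      laverage_eq_of_const_on (a := ENNReal.ofReal a) fun x hx => by
        rw [stack_on_left hF _ _ hx, hGa],
      laverage_eq_of_const_on (a := ENNReal.ofReal d) fun x hx => by
        rw [stack_zero_on_right _ hx, hGd],
      ofReal_half_add_half ha hd]
    congr 1
    simp only [stackAvg]
    norm_num
    ring
  | succ j ih =>
    have hj := stackAvg_nonneg ha hb hd j
    rw [laverage_eq_halves,
      laverage_eq_of_const_on (a := ENNReal.ofReal a) fun x hx => by
        rw [stack_on_left hF _ _ hx, hGa],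
      laverage_eq_halves _ I.right,
      laverage_congr_on (g' := fun x => G (F I.right.left x)) fun x hx =>
        congrArg G (stack_succ_on_right_left hF j I hx),
      laverage_congr_on (J := I.right.right)
        (g' := fun x => G (stack F c t j I.right.right x)) fun x hx =>
        congrArg G (stack_succ_on_right_right hF j I hx),
      hGb, ih, ofReal_half_add_half hb hj, ofReal_half_add_half ha (by positivity), stackAvg_succ]

/-- An `A_2` bound for the pieces passes to the stack, provided it dominates `4` times the product
of the averages over every `I_m`. The factor `4` accounts for the intervals `I_m^+`. -/
lemma dyadicA2_stack_le (hF : ∀ K x, x ∉ K.toSet → F K x = 0) (hc : 0 < c) (ht : 0 < t)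
    {B S S' : ℝ≥0∞} (hB : 1 ≤ B) (hFB : ∀ K, dyadicA2 (F K) K ≤ B) (hS : 4 * (S * S') ≤ B)
    (hw : ∀ j (I : DyadicInterval),
      ⨍⁻ x in I.toSet, ENNReal.ofReal (stack F c t j I x) ∂volume ≤ S)
    (hw' : ∀ j (I : DyadicInterval),
      ⨍⁻ x in I.toSet, (ENNReal.ofReal (stack F c t j I x))⁻¹ ∂volume ≤ S')
    (j : ℕ) (I : DyadicInterval) : dyadicA2 (stack F c t j I) I ≤ B := by
  have hI : ∀ j (I : DyadicInterval),
      (⨍⁻ x in I.toSet, ENNReal.ofReal (stack F c t j I x) ∂volume) *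
        (⨍⁻ x in I.toSet, (ENNReal.ofReal (stack F c t j I x))⁻¹ ∂volume) ≤ B := fun j I =>
    calc _ ≤ S * S' := mul_le_mul' (hw j I) (hw' j I)
      _ ≤ 4 * (S * S') := le_mul_of_one_le_left' (by norm_num)
      _ ≤ B := hS
  have hl : ∀ j (I : DyadicInterval), dyadicA2 (stack F c t j I) I.left ≤ B := fun j I =>
    (dyadicA2_le_one_of_const_on hc fun _ hx => stack_on_left hF j I hx).trans hB
  induction j generalizing I with
  | zero =>
    exact dyadicA2_le_of_halves (hI 0 I) (hl 0 I)
      ((dyadicA2_le_one_of_const_on (mul_pos hc ht) fun _ hx => stack_zero_on_right I hx).trans hB)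
  | succ j ih =>
    refine dyadicA2_le_of_halves (hI _ I) (hl _ I) (dyadicA2_le_of_halves ?_ ?_ ?_)
    · calc _ ≤ (2 * S) * (2 * S') :=
            mul_le_mul' ((laverage_right_le _ I).trans (by gcongr; exact hw _ I))
              ((laverage_right_le _ I).trans (by gcongr; exact hw' _ I))
        _ = 4 * (S * S') := by ring
        _ ≤ B := hS
    · rw [dyadicA2_congr (stack_succ_on_right_left hF j I)]
      exact hFB _
    · rw [dyadicA2_congr (stack_succ_on_right_right hF j I)]
      exact ih _

lemma dyadicA2_mono_interval (w : ℝ → ℝ) {I J : DyadicInterval} (h : J.toSet ⊆ I.toSet) :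
    dyadicA2 w J ≤ dyadicA2 w I :=
  iSup₂_le fun _ hK => le_dyadicA2 w (hK.trans h)

/-- The stack of height `1` sits at the bottom of every higher stack, on `I_{j-1}`. -/
lemma le_dyadicA2_stack (hF : ∀ K x, x ∉ K.toSet → F K x = 0) {B : ℝ≥0∞}
    (hB : ∀ I, B ≤ dyadicA2 (stack F c t 1 I) I) (j : ℕ) (I : DyadicInterval) :
    B ≤ dyadicA2 (stack F c t (j + 1) I) I := by
  induction j generalizing I with
  | zero => exact hB I
  | succ j ih =>
    refine (ih I.right.right).trans ?_
    rw [← dyadicA2_congr (stack_succ_on_right_right hF (j + 1) I)]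
    exact dyadicA2_mono_interval _ ((right_subset _).trans (right_subset _))

end Stack

/-! ### The weights `w_n` -/

lemma weightW_succ (k n : ℕ) (ω σ : ℝ) (I : DyadicInterval) :
    weightW k (n + 1) ω σ I =
      stack (weightW k n (3 * ω) (σ / 3)) (ω / pK k) (tauK k) (k - 1) I := by
  funext x
  rw [weightW]
  generalize k - 1 = j
  induction j generalizing I with
  | zero =>
    simp only [stack, tower, Finset.range_zero, Finset.sum_empty]
    ring
  | succ j ih =>
    rw [stack, ← ih, Finset.sum_range_succ', Finset.sum_range_succ']
    simp only [tower_succ']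
    simp only [tower]
    ring

lemma weightW_eq_zero (k n : ℕ) (ω σ : ℝ) (I : DyadicInterval) (x : ℝ) (hx : x ∉ I.toSet) :
    weightW k n ω σ I x = 0 := by
  induction n generalizing ω σ I x with
  | zero =>
    rw [weightW, chi_of_notMem fun h => hx (I.left_subset h),
      chi_of_notMem fun h => hx (I.right_subset h)]
    ring
  | succ n ih =>
    rw [weightW_succ]
    exact stack_eq_zero (ih _ _) _ _ _ hx

lemma epsK_pos (k : ℕ) : 0 < epsK k := by unfold epsK; positivity

lemma tauK_pos (k : ℕ) : 0 < tauK k := by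
  have := epsK_pos k
  unfold tauK
  positivity

lemma epsK_le {k : ℕ} (hk : 2 ≤ k) : epsK k ≤ 1 / 16 := by
  unfold epsK
  apply one_div_le_one_div_of_le (by norm_num)
  calc (16 : ℝ) = 4 ^ 2 := by norm_num
    _ ≤ 4 ^ k := pow_le_pow_right₀ (by norm_num) hk

lemma inv_tauK (k : ℕ) : 1 / tauK k = (1 / epsK k + 5) / 9 := by
  have := epsK_pos k
  unfold tauK
  field_simp

lemma tauK_le (k : ℕ) : tauK k ≤ 9 * epsK k := by
  have := epsK_pos k
  exact div_le_self (by positivity) (by linarith)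

lemma pK_mul_epsK (k : ℕ) :
    pK k * (4 * epsK k) = 2 / 3 * (1 - epsK k) + 2 * epsK k * tauK k := by
  have := epsK_pos k
  unfold pK
  field_simp

lemma pK_ge {k : ℕ} (hk : 2 ≤ k) : 5 / 32 * (1 / epsK k) ≤ pK k := by
  have h := epsK_pos k
  have h1 := epsK_le hk
  have h2 := pK_mul_epsK k
  have h3 := mul_pos h (tauK_pos k)
  rw [mul_one_div, div_le_iff₀ h]
  linarith

lemma pK_le {k : ℕ} (hk : 2 ≤ k) : pK k ≤ 7 / 40 * (1 / epsK k) := by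
  have h := epsK_pos k
  have h1 := epsK_le hk
  have h2 := pK_mul_epsK k
  have h3 : epsK k * tauK k ≤ 1 / 16 * (9 * epsK k) :=
    mul_le_mul h1 (tauK_le k) (tauK_pos k).le (by norm_num)
  rw [mul_one_div, le_div_iff₀ h]
  linarith

lemma sixteen_le_inv_epsK {k : ℕ} (hk : 2 ≤ k) : 16 ≤ 1 / epsK k := by
  rw [le_div_iff₀ (epsK_pos k)]
  linarith [epsK_le hk]

lemma five_halves_le_pK {k : ℕ} (hk : 2 ≤ k) : 5 / 2 ≤ pK k := by
  linarith [pK_ge hk, sixteen_le_inv_epsK hk]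

/-- With the parameters of `w`, a stack of height `k - 1` has average `ω`: this is the equation
that defines `p`. -/
lemma stackAvg_weight {k : ℕ} (hk : 2 ≤ k) (ω : ℝ) :
    stackAvg (ω / pK k) (3 * ω) (ω / pK k * tauK k) (k - 1) = ω := by
  have hp : pK k ≠ 0 := by linarith [five_halves_le_pK hk]
  have he : (1 : ℝ) / 4 ^ (k - 1) = 4 * epsK k := by
    obtain ⟨j, rfl⟩ := Nat.exists_eq_add_of_le' (show 1 ≤ k by omega)
    rw [epsK, Nat.add_sub_cancel, pow_succ]
    field_simp
  unfold stackAvg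
  rw [div_eq_mul_one_div _ ((4 : ℝ) ^ (k - 1)), he]
  field_simp
  linear_combination (-6 * ω) * pK_mul_epsK k

/-- The analogue for the reciprocal weight: this is the equation that defines `τ`. -/
lemma stackAvg_inv_weight {k : ℕ} (hk : 2 ≤ k) (σ : ℝ) :
    stackAvg σ (σ / 3) (σ * (1 / tauK k)) (k - 1) = σ := by
  have he0 := (epsK_pos k).ne'
  have he : (1 : ℝ) / 4 ^ (k - 1) = 4 * epsK k := by
    obtain ⟨j, rfl⟩ := Nat.exists_eq_add_of_le' (show 1 ≤ k by omega)
    rw [epsK, Nat.add_sub_cancel, pow_succ]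
    field_simp
  unfold stackAvg
  rw [div_eq_mul_one_div _ ((4 : ℝ) ^ (k - 1)), he, inv_tauK]
  field_simp
  ring

lemma inv_ofReal_const {k : ℕ} (hk : 2 ≤ k) {ω σ : ℝ} (hω : 0 < ω) (h : ω * σ = pK k) :
    (ENNReal.ofReal (ω / pK k))⁻¹ = ENNReal.ofReal σ := by
  have hp : 0 < pK k := by linarith [five_halves_le_pK hk]
  rw [← ENNReal.ofReal_inv_of_pos (by positivity), inv_div, ← h, mul_div_cancel_left₀ _ hω.ne']

lemma inv_ofReal_const_mul_tauK {k : ℕ} (hk : 2 ≤ k) {ω σ : ℝ} (hω : 0 < ω) (h : ω * σ = pK k) :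
    (ENNReal.ofReal (ω / pK k * tauK k))⁻¹ = ENNReal.ofReal (σ * (1 / tauK k)) := by
  have hp : 0 < pK k := by linarith [five_halves_le_pK hk]
  have ht := tauK_pos k
  rw [← ENNReal.ofReal_inv_of_pos (by positivity), mul_inv, inv_div, ← h,
    mul_div_cancel_left₀ _ hω.ne', one_div]

section Base

variable {k : ℕ} {ω σ : ℝ} {I : DyadicInterval}

lemma weightW_zero_on_left {x : ℝ} (hx : x ∈ I.left.toSet) :
    weightW k 0 ω σ I x = ω / √(pK k) * (√(pK k) - √(pK k - 1)) := by
  rw [weightW, chi_of_mem hx, chi_of_notMem (notMem_right_of_mem_left hx)]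
  ring

lemma weightW_zero_on_right {x : ℝ} (hx : x ∈ I.right.toSet) :
    weightW k 0 ω σ I x = ω / √(pK k) * (√(pK k) + √(pK k - 1)) := by
  rw [weightW, chi_of_mem hx, chi_of_notMem (notMem_left_of_mem_right hx)]
  ring

lemma weightW_zero_value_pos (hk : 2 ≤ k) (hω : 0 < ω) :
    0 < ω / √(pK k) * (√(pK k) - √(pK k - 1)) ∧
      0 < ω / √(pK k) * (√(pK k) + √(pK k - 1)) := by
  have hp := five_halves_le_pK hk
  have h0 : 0 < √(pK k) := Real.sqrt_pos.2 (by linarith)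
  have h1 : √(pK k - 1) < √(pK k) := Real.sqrt_lt_sqrt (by linarith) (by linarith)
  have h2 : 0 < √(pK k) - √(pK k - 1) := by linarith
  constructor <;> positivity

lemma laverage_weightW_zero (hk : 2 ≤ k) (hω : 0 < ω) :
    ⨍⁻ x in I.toSet, ENNReal.ofReal (weightW k 0 ω σ I x) ∂volume = ENNReal.ofReal ω := by
  obtain ⟨hl, hr⟩ := weightW_zero_value_pos hk hω
  have h0 : 0 < √(pK k) := Real.sqrt_pos.2 (by linarith [five_halves_le_pK hk])
  rw [laverage_eq_halves,
    laverage_eq_of_const_on fun x hx => congrArg ENNReal.ofReal (weightW_zero_on_left hx),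
    laverage_eq_of_const_on fun x hx => congrArg ENNReal.ofReal (weightW_zero_on_right hx),
    ofReal_half_add_half hl.le hr.le]
  congr 1
  field_simp
  ring

lemma laverage_inv_weightW_zero (hk : 2 ≤ k) (hω : 0 < ω) (h : ω * σ = pK k) :
    ⨍⁻ x in I.toSet, (ENNReal.ofReal (weightW k 0 ω σ I x))⁻¹ ∂volume = ENNReal.ofReal σ := by
  obtain ⟨hl, hr⟩ := weightW_zero_value_pos hk hω
  have hp := five_halves_le_pK hk
  have h0 : 0 < √(pK k) := Real.sqrt_pos.2 (by linarith)
  have hsq : √(pK k) ^ 2 = pK k := Real.sq_sqrt (by linarith)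
  have hsq' : √(pK k - 1) ^ 2 = pK k - 1 := Real.sq_sqrt (by linarith)
  -- The two reciprocals are the conjugates, because `√p - √(p-1)` and `√p + √(p-1)` are inverse.
  have hi : (ω / √(pK k) * (√(pK k) - √(pK k - 1)))⁻¹ =
      √(pK k) / ω * (√(pK k) + √(pK k - 1)) := by
    apply inv_eq_of_mul_eq_one_right
    field_simp
    linear_combination hsq - hsq'
  have hi' : (ω / √(pK k) * (√(pK k) + √(pK k - 1)))⁻¹ =
      √(pK k) / ω * (√(pK k) - √(pK k - 1)) := by
    apply inv_eq_of_mul_eq_one_right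
    field_simp
    linear_combination hsq - hsq'
  rw [laverage_eq_halves,
    laverage_eq_of_const_on fun x hx =>
      congrArg (fun y => (ENNReal.ofReal y)⁻¹) (weightW_zero_on_left hx),
    laverage_eq_of_const_on fun x hx =>
      congrArg (fun y => (ENNReal.ofReal y)⁻¹) (weightW_zero_on_right hx),
    ← ENNReal.ofReal_inv_of_pos hl, ← ENNReal.ofReal_inv_of_pos hr,
    ofReal_half_add_half (inv_nonneg.2 hl.le) (inv_nonneg.2 hr.le), hi, hi']
  congr 1
  field_simp
  linear_combination 2 * hsq - 2 * h

end Base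

/-- The averages of `w_n` and of its reciprocal over `I` are `ω` and `σ`. -/
lemma laverage_weightW {k : ℕ} (hk : 2 ≤ k) (n : ℕ) {ω σ : ℝ} (hω : 0 < ω) (hσ : 0 < σ)
    (h : ω * σ = pK k) (I : DyadicInterval) :
    ⨍⁻ x in I.toSet, ENNReal.ofReal (weightW k n ω σ I x) ∂volume = ENNReal.ofReal ω ∧
      ⨍⁻ x in I.toSet, (ENNReal.ofReal (weightW k n ω σ I x))⁻¹ ∂volume = ENNReal.ofReal σ := by
  induction n generalizing ω σ I with
  | zero => exact ⟨laverage_weightW_zero hk hω, laverage_inv_weightW_zero hk hω h⟩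
  | succ n ih =>
    have hp : 0 < pK k := by linarith [five_halves_le_pK hk]
    have ht := tauK_pos k
    have ih' := fun K => ih (ω := 3 * ω) (σ := σ / 3) (by positivity) (by positivity)
      (by rw [← h]; ring) K
    rw [weightW_succ]
    constructor
    · rw [laverage_stack (weightW_eq_zero k n _ _) (G := ENNReal.ofReal) (by positivity)
        (by positivity) (by positivity) rfl rfl (fun K => (ih' K).1), stackAvg_weight hk]
    · rw [laverage_stack (weightW_eq_zero k n _ _) (G := fun y => (ENNReal.ofReal y)⁻¹)
        hσ.le (by positivity) (by positivity) (inv_ofReal_const hk hω h)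
        (inv_ofReal_const_mul_tauK hk hω h) (fun K => (ih' K).2), stackAvg_inv_weight hk]

/-- The averages of `w_{n+1}` and of its reciprocal over `I_{k-1-j}`, where `w_{n+1}` is a stack of
height `j`. -/
lemma laverage_stack_weightW {k : ℕ} (hk : 2 ≤ k) (n : ℕ) {ω σ : ℝ} (hω : 0 < ω) (hσ : 0 < σ)
    (h : ω * σ = pK k) (j : ℕ) (I : DyadicInterval) :
    ⨍⁻ x in I.toSet, ENNReal.ofReal
        (stack (weightW k n (3 * ω) (σ / 3)) (ω / pK k) (tauK k) j I x) ∂volume =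
      ENNReal.ofReal (stackAvg (ω / pK k) (3 * ω) (ω / pK k * tauK k) j) ∧
    ⨍⁻ x in I.toSet, (ENNReal.ofReal
        (stack (weightW k n (3 * ω) (σ / 3)) (ω / pK k) (tauK k) j I x))⁻¹ ∂volume =
      ENNReal.ofReal (stackAvg σ (σ / 3) (σ * (1 / tauK k)) j) := by
  have hp : 0 < pK k := by linarith [five_halves_le_pK hk]
  have ht := tauK_pos k
  have ih' := fun K => laverage_weightW hk n (ω := 3 * ω) (σ := σ / 3) (by positivity)
    (by positivity) (by rw [← h]; ring) K
  exact ⟨laverage_stack (weightW_eq_zero k n _ _) (G := ENNReal.ofReal) (by positivity)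
      (by positivity) (by positivity) rfl rfl (fun K => (ih' K).1) j I,
    laverage_stack (weightW_eq_zero k n _ _) (G := fun y => (ENNReal.ofReal y)⁻¹)
      hσ.le (by positivity) (by positivity) (inv_ofReal_const hk hω h)
      (inv_ofReal_const_mul_tauK hk hω h) (fun K => (ih' K).2) j I⟩

lemma stackAvg_weight_le {k : ℕ} (hk : 2 ≤ k) {ω : ℝ} (hω : 0 < ω) (j : ℕ) :
    stackAvg (ω / pK k) (3 * ω) (ω / pK k * tauK k) j ≤ 2 * ω := by
  have hp := five_halves_le_pK hk
  have ht := tauK_pos k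
  have ht1 : tauK k ≤ 1 := by linarith [tauK_le k, epsK_le hk]
  have hp0 : 0 < pK k := by linarith
  have ha : ω / pK k ≤ 2 / 5 * ω := by
    rw [div_le_iff₀ hp0]
    nlinarith
  have ha0 : 0 < ω / pK k := by positivity
  have hd : ω / pK k * tauK k ≤ ω / pK k := mul_le_of_le_one_right ha0.le ht1
  refine (stackAvg_le ha0.le (by positivity) (by positivity) j).trans ?_
  linarith

lemma stackAvg_inv_weight_le {k : ℕ} (hk : 2 ≤ k) {σ : ℝ} (hσ : 0 < σ) (j : ℕ) :
    stackAvg σ (σ / 3) (σ * (1 / tauK k)) j ≤ pK k * σ := by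
  have ht := tauK_pos k
  refine (stackAvg_le hσ.le (by positivity) (by positivity) j).trans ?_
  have h2 : (1 + 1 / tauK k) / 2 + (2 + 1 / 3) / 3 ≤ pK k := by
    rw [inv_tauK]
    linarith [pK_ge hk, sixteen_le_inv_epsK hk]
  calc _ = ((1 + 1 / tauK k) / 2 + (2 + 1 / 3) / 3) * σ := by ring
    _ ≤ pK k * σ := mul_le_mul_of_nonneg_right h2 hσ.le

lemma dyadicA2_weightW_le {k : ℕ} (hk : 2 ≤ k) (n : ℕ) {ω σ : ℝ} (hω : 0 < ω) (hσ : 0 < σ)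
    (h : ω * σ = pK k) (I : DyadicInterval) :
    dyadicA2 (weightW k n ω σ I) I ≤ ENNReal.ofReal (8 * pK k ^ 2) := by
  have hp := five_halves_le_pK hk
  have hp0 : 0 < pK k := by linarith
  have hB : 1 ≤ ENNReal.ofReal (8 * pK k ^ 2) := by
    rw [ENNReal.one_le_ofReal]
    nlinarith
  induction n generalizing ω σ I with
  | zero =>
    obtain ⟨hl, hr⟩ := weightW_zero_value_pos hk hω
    refine dyadicA2_le_of_halves ?_
      ((dyadicA2_le_one_of_const_on hl fun _ hx => weightW_zero_on_left hx).trans hB)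
      ((dyadicA2_le_one_of_const_on hr fun _ hx => weightW_zero_on_right hx).trans hB)
    rw [(laverage_weightW hk 0 hω hσ h I).1, (laverage_weightW hk 0 hω hσ h I).2,
      ← ENNReal.ofReal_mul hω.le, h]
    apply ENNReal.ofReal_le_ofReal
    nlinarith
  | succ n ih =>
    have hS : 4 * (ENNReal.ofReal (2 * ω) * ENNReal.ofReal (pK k * σ)) ≤
        ENNReal.ofReal (8 * pK k ^ 2) := by
      rw [← ENNReal.ofReal_mul (by positivity), ← ENNReal.ofReal_ofNat (n := 4),
        ← ENNReal.ofReal_mul (by positivity)]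
      apply ENNReal.ofReal_le_ofReal
      linear_combination 8 * pK k * h
    rw [weightW_succ]
    refine dyadicA2_stack_le (weightW_eq_zero k n _ _) (by positivity) (tauK_pos k) hB
      (fun K => ih (by positivity) (by positivity) (by rw [← h]; ring) K) hS
      (fun j K => ?_) (fun j K => ?_) _ _
    · rw [(laverage_stack_weightW hk n hω hσ h j K).1]
      exact ENNReal.ofReal_le_ofReal (stackAvg_weight_le hk hω j)
    · rw [(laverage_stack_weightW hk n hω hσ h j K).2]
      exact ENNReal.ofReal_le_ofReal (stackAvg_inv_weight_le hk hσ j)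

lemma le_dyadicA2_weightW_succ {k : ℕ} (hk : 2 ≤ k) (n : ℕ) {ω σ : ℝ} (hω : 0 < ω) (hσ : 0 < σ)
    (h : ω * σ = pK k) (I : DyadicInterval) :
    ENNReal.ofReal (1 / 20 * pK k ^ 2) ≤ dyadicA2 (weightW k (n + 1) ω σ I) I := by
  have hp0 : 0 < pK k := by linarith [five_halves_le_pK hk]
  have ht := tauK_pos k
  obtain ⟨j, hj⟩ := Nat.exists_eq_add_of_le' (show 1 ≤ k - 1 by omega)
  rw [weightW_succ, hj]
  refine le_dyadicA2_stack (weightW_eq_zero k n _ _) (fun K => ?_) j I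
  refine le_trans ?_ (le_dyadicA2 _ subset_rfl)
  have hA : 3 / 4 * ω ≤ stackAvg (ω / pK k) (3 * ω) (ω / pK k * tauK k) 1 := by
    have h1 : 0 < ω / pK k := by positivity
    have h2 : 0 < ω / pK k * tauK k := by positivity
    unfold stackAvg
    linarith
  have hA' : 1 / 15 * pK k * σ ≤ stackAvg σ (σ / 3) (σ * (1 / tauK k)) 1 := by
    have h1 : 1 / 15 * pK k ≤ 1 / tauK k / 8 := by
      rw [inv_tauK]
      linarith [pK_le hk, sixteen_le_inv_epsK hk]
    have h2 := mul_le_mul_of_nonneg_right h1 hσ.le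
    unfold stackAvg
    linarith
  rw [(laverage_stack_weightW hk n hω hσ h 1 K).1, (laverage_stack_weightW hk n hω hσ h 1 K).2,
    ← ENNReal.ofReal_mul (stackAvg_nonneg (by positivity) (by positivity) (by positivity) 1)]
  apply ENNReal.ofReal_le_ofReal
  calc 1 / 20 * pK k ^ 2 = (3 / 4 * ω) * (1 / 15 * pK k * σ) := by
        linear_combination (-1 / 20 * pK k) * h
    _ ≤ _ := mul_le_mul hA hA' (by positivity) (le_trans (by positivity) hA)

theorem lemma2p2 :
    ∃ c C : ℝ, 0 < c ∧ 0 < C ∧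
      ∀ (k n : ℕ), 2 ≤ k → 1 ≤ n →
        ∀ (ω σ : ℝ), 0 < ω → 0 < σ → ω * σ = pK k →
          ∀ I : DyadicInterval,
            ENNReal.ofReal (c * pK k ^ 2) ≤ dyadicA2 (weightW k n ω σ I) I ∧
              dyadicA2 (weightW k n ω σ I) I ≤ ENNReal.ofReal (C * pK k ^ 2) := by
  refine ⟨1 / 20, 8, by norm_num, by norm_num, fun k n hk hn ω σ hω hσ h I => ⟨?_, ?_⟩⟩
  · obtain ⟨m, rfl⟩ := Nat.exists_eq_add_of_le' hn
    exact le_dyadicA2_weightW_succ hk m hω hσ h I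
  · exact dyadicA2_weightW_le hk n hω hσ h I
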